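/- **Theorem.** Let $\ell$ be a prime. Let $X$ be a finite graph in the sense of Serre (loops and parallel edges allowed), with vertex set $V_X$, set of directed edges $\mathbf E_X$, origin and terminus maps $o,t$, and edge inversion $e\mapsto\bar e$. Let $S\subseteq\mathbf E_X$ be an orientation, i.e. $S$ contains exactly one of $e,\bar e$ for every $e\in\mathbf E_X$. For a finite group $K$ and a voltage assignment $\alpha:S\to K$, extended to $\mathbf E_X$ by $\alpha(\bar s)=\alpha(s)^{-1}$, let $X(K,S,\alpha)$ be the graph with vertex set $V_X\times K$ and directed edge set $\mathbf E_X\times K$, where $(e,\sigma)$ goes from $(o(e),\sigma)$ to $(t(e),\sigma\alpha(e))$ and $\overline{(e,\sigma)}=(\bar e,\sigma\alpha(e))$. For a finite graph $Y$ with orientation $S_Y$ and a function $\delta:S_Y\to\mathbb Z_\ell$, let $f_{Y,\delta}(T)=\det(D-A_\rho)\in\mathbb Z_\ell[[T]]$, where $D$ is the diagonal matrix of valencies of $Y$ and $$(A_\rho)_{v,w}=\sum_{s\in S_Y,\ (o(s),t(s))=(v,w)}(1+T)^{\delta(s)}+\sum_{s\in S_Y,\ (o(s),t(s))=(w,v)}(1+T)^{-\delta(s)}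 .$$ For $Q=\sum_i a_iT^i\in\mathbb Z_\ell[[T]]$ put $\mu(Q)=\min_i\operatorname{ord}_\ell(a_i)$ (with $\operatorname{ord}_\ell(0)=\infty$) and $\lambda(Q)=\min\{i:\operatorname{ord}_\ell(a_i)=\mu(Q)\}$. The Iwasawa invariants of the tower $\big(Y(\mathbb Z/\ell^m\mathbb Z,S_Y,\delta \bmod \ell^m)\big)_{m\ge 0}$ over $Y$ are $\mu(Y,\delta)=\mu(f_{Y,\delta})$ and $\lambda(Y,\delta)=\lambda(f_{Y,\delta})-1$. Let $G$ be a pro-$\ell$ group, let $G_0=G$ and $G_{n+1}=(G_n)^\ell[G_n,G]$, and assume that $G$ is uniform of dimension $d$: it is topologically finitely generated, $[G,G]\subseteq G^\ell$ if $\ell$ is odd and $[G,G]\subseteq G^4$ if $\ell=2$, $[G_n:G_{n+1}]=[G:G_1]$ for all $n\ge 1$, and $[G:G_1]=\ell^d$ (here $H^k$ is the subgroup generated by the $k$-th powers of elements of $H$). Let $\alpha:S\to G$ and $\beta:S\to\mathbb Z_\ell$ be functions, with reductions $\alpha_{/n}:S\to G/G_n$ and $\beta_{/m}:S\to\mathbb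 Z/\ell^m\mathbb Z$. For $n,m\ge 0$ put $$Y_n=X(G/G_n,S,\alpha_{/n}),\qquad Y_{n,m}=X\big(G/G_n\times\mathbb Z/\ell^m\mathbb Z,\,S,\,(\alpha_{/n},\beta_{/m})\big),$$ let $p_n:Y_n\to X$ be the projection, and let $\mathcal Y_n$ be the tower $(Y_{n,m})_{m\ge 0}$ over $Y_n$, with the natural maps. Assume that $Y_{n,m}$ is connected for all $n,m\ge 0$. Then for every $n$ the tower $\mathcal Y_n$ is isomorphic, compatibly with the projections to $Y_n$ and with the transition maps, to the tower $\big(Y_n(\mathbb Z/\ell^m\mathbb Z,\,p_n^{-1}(S),\,(\beta\circ p_n)\bmod \ell^m)\big)_{m\ge 0}$, which is the pullback along $p_n$ of the tower over $X$ attached to $\beta$. Let $\mu_n=\mu(Y_n,\beta\circ p_n)$ and $\lambda_n=\lambda(Y_n,\beta\circ p_n)$ be its Iwasawa invariants, and put $\mu=\mu_0$, $\lambda=\lambda_0$. Then $\mu=\mu(X,\beta)$ and $\lambda=\lambda(X,\beta)$; and if $\mu=0$, then for all $n\ge 0$ $$\mu_n=0\qquad\text{and}\qquad \lambda_n=\ell^{dn}(\lambda+1)-1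 .$$ -/

import Mathlib

/-- A graph in the sense of Serre: directed edges with origin, terminus and a fixed-point-free
inversion. Loops and parallel edges are allowed. -/
structure SerreGraph.{u, v} where
  V : Type u
  E : Type v
  o : E → V
  t : E → V
  inv : E → E
  inv_ne : ∀ e, inv e ≠ e
  inv_inv : ∀ e, inv (inv e) = e
  o_inv : ∀ e, o (inv e) = t e
  t_inv : ∀ e, t (inv e) = o e

namespace SerreGraph

/-- A graph is connected if it is nonempty and any two vertices are joined by a path. -/
def Connected (X : SerreGraph) : Prop :=
  Nonempty X.V ∧ ∀ v w : X.V, Relation.ReflTransGen (fun a b => ∃ e, X.o e = a ∧ X.t e = b) v w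

/-- The valency of a vertex: the number of directed edges with origin `v`. -/
noncomputable def val (X : SerreGraph) (v : X.V) : ℕ := Nat.card {e : X.E // X.o e = v}

/-- Morphisms of graphs. -/
structure Hom (Y X : SerreGraph) where
  onV : Y.V → X.V
  onE : Y.E → X.E
  map_o : ∀ e, onV (Y.o e) = X.o (onE e)
  map_t : ∀ e, onV (Y.t e) = X.t (onE e)
  map_inv : ∀ e, onE (Y.inv e) = X.inv (onE e)

/-- A morphism is an isomorphism if it is bijective on vertices and on directed edges. -/
def Hom.IsIso {Y X : SerreGraph} (f : Hom Y X) : Prop :=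
  Function.Bijective f.onV ∧ Function.Bijective f.onE

/-- Composition of morphisms of graphs. -/
def Hom.comp {Z Y X : SerreGraph} (g : Hom Y X) (f : Hom Z Y) : Hom Z X where
  onV := g.onV ∘ f.onV
  onE := g.onE ∘ f.onE
  map_o e := by simp [f.map_o, g.map_o]
  map_t e := by simp [f.map_t, g.map_t]
  map_inv e := by simp [f.map_inv, g.map_inv]

/-- An orientation: a set of directed edges containing exactly one of `e` and `inv e`
for every directed edge `e`. -/
structure Orientation (X : SerreGraph) where
  carrier : Set X.E
  inv_notMem : ∀ e ∈ carrier, X.inv e ∉ carrier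
  mem_or : ∀ e, e ∈ carrier ∨ X.inv e ∈ carrier

/-- The orientation of `Y` induced by an orientation of `X` along a morphism `Y → X`. -/
def Orientation.comap {Y X : SerreGraph} (f : Hom Y X) (S : Orientation X) : Orientation Y where
  carrier := f.onE ⁻¹' S.carrier
  inv_notMem e he := by
    simp only [Set.mem_preimage, f.map_inv]
    exact S.inv_notMem _ he
  mem_or e := by
    simp only [Set.mem_preimage, f.map_inv]
    exact S.mem_or _

/-- The extension of a voltage assignment from the orientation `S` to all directed edges,
by `α (inv s) = (α s)⁻¹`. -/
noncomputable def extend {X : SerreGraph} (S : Orientation X) {K : Type*} [Group K]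
    (α : S.carrier → K) (e : X.E) : K :=
  open Classical in
  if h : e ∈ S.carrier then α ⟨e, h⟩ else (α ⟨X.inv e, (S.mem_or e).resolve_left h⟩)⁻¹

theorem extend_inv {X : SerreGraph} (S : Orientation X) {K : Type*} [Group K]
    (α : S.carrier → K) (e : X.E) : extend S α (X.inv e) = (extend S α e)⁻¹ := by
  unfold extend
  by_cases h : e ∈ S.carrier
  · have h2 := S.inv_notMem e h
    simp [h, h2, X.inv_inv]
  · have h2 := (S.mem_or e).resolve_left h
    simp [h, h2]

theorem extend_map {X : SerreGraph} (S : Orientation X) {K L : Type*} [Group K] [Group L]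
    (f : K →* L) (α : S.carrier → K) (e : X.E) :
    extend S (fun s => f (α s)) e = f (extend S α e) := by
  unfold extend
  split <;> simp

/-- The derived graph `X(K, S, α)` of a voltage assignment `α : S → K`. -/
noncomputable def derived (X : SerreGraph) (S : Orientation X) {K : Type*} [Group K]
    (α : S.carrier → K) : SerreGraph where
  V := X.V × K
  E := X.E × K
  o e := (X.o e.1, e.2)
  t e := (X.t e.1, e.2 * extend S α e.1)
  inv e := (X.inv e.1, e.2 * extend S α e.1)
  inv_ne e h := X.inv_ne e.1 (congrArg Prod.fst h)
  inv_inv e := by simp [X.inv_inv, extend_inv]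
  o_inv e := by simp [X.o_inv]
  t_inv e := by simp [X.t_inv, extend_inv]

instance {X : SerreGraph} [Finite X.V] (S : Orientation X) {K : Type*} [Group K] [Finite K]
    (α : S.carrier → K) : Finite (derived X S α).V :=
  inferInstanceAs (Finite (X.V × K))

instance {X : SerreGraph} [Finite X.E] (S : Orientation X) {K : Type*} [Group K] [Finite K]
    (α : S.carrier → K) : Finite (derived X S α).E :=
  inferInstanceAs (Finite (X.E × K))

/-- The projection `X(K, S, α) → X`. -/
noncomputable def derivedProj (X : SerreGraph) (S : Orientation X) {K : Type*} [Group K]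
    (α : S.carrier → K) : Hom (derived X S α) X where
  onV := Prod.fst
  onE := Prod.fst
  map_o _ := rfl
  map_t _ := rfl
  map_inv _ := rfl

/-- The morphism `X(K, S, α) → X(L, S, α')` induced by a group morphism `f : K → L` with
`α' = f ∘ α`. -/
noncomputable def derivedMap (X : SerreGraph) (S : Orientation X) {K L : Type*} [Group K] [Group L]
    (f : K →* L) (α : S.carrier → K) (α' : S.carrier → L) (h : α' = fun s => f (α s)) :
    Hom (derived X S α) (derived X S α') where
  onV v := (v.1, f v.2)
  onE e := (e.1, f e.2)
  map_o _ := rfl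
  map_t e := by subst h; simp [derived, extend_map]
  map_inv e := by subst h; simp [derived, extend_map]

/-- A sequence of graphs over a graph `Y`, with transition morphisms compatible with the
projections to `Y`. -/
structure Tower.{u, v} (Y : SerreGraph.{u, v}) where
  level : ℕ → SerreGraph.{u, v}
  proj : ∀ m, Hom (level m) Y
  trans : ∀ m, Hom (level (m + 1)) (level m)
  proj_trans : ∀ m, (proj m).comp (trans m) = proj (m + 1)

/-- Two towers over `Y` are isomorphic if there are isomorphisms between their levels that
commute with the projections to `Y` and with the transition morphisms. -/
def Tower.Isomorphic {Y : SerreGraph} (T T' : Tower Y) : Prop :=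
  ∃ φ : ∀ m, Hom (T.level m) (T'.level m), ∀ m,
    (φ m).IsIso ∧ (T'.proj m).comp (φ m) = T.proj m ∧
      (T'.trans m).comp (φ (m + 1)) = (φ m).comp (T.trans m)

section Iwasawa

variable {ℓ : ℕ} [Fact ℓ.Prime]

/-- The group `ℤ/ℓ^m ℤ`, written multiplicatively. -/
abbrev Cyc (ℓ m : ℕ) : Type := Multiplicative (ZMod (ℓ ^ m))

instance cyc_finite (m : ℕ) : Finite (Cyc ℓ m) :=
  haveI : NeZero (ℓ ^ m) := ⟨pow_ne_zero _ (Fact.out : ℓ.Prime).ne_zero⟩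
  inferInstanceAs (Finite (ZMod (ℓ ^ m)))

/-- Reduction `ℤ/ℓ^(m+1) → ℤ/ℓ^m`. -/
def cycRed (ℓ m : ℕ) : Cyc ℓ (m + 1) →* Cyc ℓ m :=
  AddMonoidHom.toMultiplicative
    (ZMod.castHom (pow_dvd_pow ℓ (Nat.le_succ m)) (ZMod (ℓ ^ m))).toAddMonoidHom

/-- The reduction modulo `ℓ^m` of an `ℓ`-adic integer. -/
noncomputable def redMod (m : ℕ) (a : ℤ_[ℓ]) : Cyc ℓ m :=
  Multiplicative.ofAdd (PadicInt.toZModPow m a)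

theorem cycRed_redMod (m : ℕ) (a : ℤ_[ℓ]) : cycRed ℓ m (redMod (m + 1) a) = redMod m a :=
  congrArg Multiplicative.ofAdd
    (DFunLike.congr_fun (PadicInt.zmod_cast_comp_toZModPow m (m + 1) (Nat.le_succ m)) a)

/-- The tower `Y ← Y(ℤ/ℓ, S, β mod ℓ) ← Y(ℤ/ℓ², S, β mod ℓ²) ← ⋯` attached to a voltage
assignment `β : S → ℤ_ℓ`. -/
noncomputable def voltageTower (Y : SerreGraph) (S : Orientation Y) (β : S.carrier → ℤ_[ℓ]) :
    Tower Y where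
  level m := derived Y S (fun s => redMod m (β s))
  proj m := derivedProj Y S _
  trans m := derivedMap Y S (cycRed ℓ m) _ _ (funext fun s => (cycRed_redMod m (β s)).symm)
  proj_trans _ := rfl

/-- The pullback to `X(K, S, α)` of the voltage tower of `β`: its `m`-th level is
`X(K × ℤ/ℓ^m, S, (α, β mod ℓ^m))`. -/
noncomputable def productTower (X : SerreGraph) (S : Orientation X) {K : Type*} [Group K]
    (α : S.carrier → K) (β : S.carrier → ℤ_[ℓ]) : Tower (derived X S α) where
  level m := derived X S (fun s => (α s, redMod m (β s)))
  proj m := derivedMap X S (MonoidHom.fst K (Cyc ℓ m)) _ _ rfl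
  trans m := derivedMap X S (MonoidHom.prodMap (MonoidHom.id K) (cycRed ℓ m)) _ _
    (funext fun s => Prod.ext rfl (cycRed_redMod m (β s)).symm)
  proj_trans _ := rfl

/-- The matrix `A_ρ` over `ℤ_ℓ⟦T⟧`, with `ρ(a) = (1 + T)^a`. -/
noncomputable def adjRho (Y : SerreGraph) [Finite Y.E] (S : Orientation Y)
    (β : S.carrier → ℤ_[ℓ]) : Matrix Y.V Y.V (PowerSeries ℤ_[ℓ]) :=
  open Classical in
  letI : Fintype S.carrier := Fintype.ofFinite S.carrier
  fun i j =>
    ∑ s : S.carrier,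
      ((if Y.o s = i ∧ Y.t s = j then PowerSeries.binomialSeries ℤ_[ℓ] (β s) else 0) +
        (if Y.o s = j ∧ Y.t s = i then PowerSeries.binomialSeries ℤ_[ℓ] (-β s) else 0))

/-- The characteristic series `f_{Y,β}(T) = det (D - A_ρ)`, where `D` is the diagonal matrix of
valencies. -/
noncomputable def charSeries (Y : SerreGraph) [Finite Y.V] [Finite Y.E] (S : Orientation Y)
    (β : S.carrier → ℤ_[ℓ]) : PowerSeries ℤ_[ℓ] :=
  open Classical in
  letI : Fintype Y.V := Fintype.ofFinite Y.V
  (Matrix.diagonal (fun v => (Y.val v : PowerSeries ℤ_[ℓ])) - adjRho Y S β).det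

/-- `ord_ℓ` on `ℤ_ℓ`, with `ord_ℓ 0 = ⊤`. -/
noncomputable def ord (a : ℤ_[ℓ]) : ℕ∞ := emultiplicity (ℓ : ℤ_[ℓ]) a

/-- The `μ`-invariant of a power series: the minimum of `ord_ℓ` of the coefficients. -/
noncomputable def seriesMu (Q : PowerSeries ℤ_[ℓ]) : ℕ∞ := ⨅ i, ord (PowerSeries.coeff i Q)

/-- The `λ`-invariant of a power series: the least index at which the minimum is attained. -/
noncomputable def seriesLambda (Q : PowerSeries ℤ_[ℓ]) : ℕ :=
  sInf {i | ord (PowerSeries.coeff i Q) = seriesMu Q}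

/-- The Iwasawa `μ`-invariant `μ(Y, β)` of the voltage tower of `β`. -/
noncomputable def muInv (Y : SerreGraph) [Finite Y.V] [Finite Y.E] (S : Orientation Y)
    (β : S.carrier → ℤ_[ℓ]) : ℕ∞ := seriesMu (charSeries Y S β)

/-- The Iwasawa `λ`-invariant `λ(Y, β)` of the voltage tower of `β`. -/
noncomputable def lambdaInv (Y : SerreGraph) [Finite Y.V] [Finite Y.E] (S : Orientation Y)
    (β : S.carrier → ℤ_[ℓ]) : ℤ := (seriesLambda (charSeries Y S β) : ℤ) - 1

end Iwasawa

end SerreGraph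

/-- The subgroup `H^k` generated by the `k`-th powers of elements of `H`. -/
def powSubgroup {G : Type*} [Group G] (k : ℕ) (H : Subgroup G) : Subgroup G :=
  Subgroup.closure {x | ∃ h ∈ H, h ^ k = x}

instance powSubgroup_normal {G : Type*} [Group G] (k : ℕ) (H : Subgroup G) [hH : H.Normal] :
    (powSubgroup k H).Normal := by
  have : powSubgroup k H = Subgroup.normalClosure {x | ∃ h ∈ H, h ^ k = x} := by
    refine le_antisymm Subgroup.closure_le_normalClosure ?_
    refine (Subgroup.closure_le _).2 fun y hy => Subgroup.subset_closure ?_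
    obtain ⟨x, ⟨h, hh, rfl⟩, hc⟩ := Group.mem_conjugatesOfSet_iff.1 hy
    obtain ⟨c, rfl⟩ := isConj_iff.1 hc
    exact ⟨c * h * c⁻¹, hH.conj_mem h hh c, conj_pow⟩
  rw [this]
  infer_instance

/-- The lower central `ℓ`-series: `G_0 = G` and `G_{n+1} = (G_n)^ℓ [G_n, G]`. -/
def lowerSeries (ℓ : ℕ) (G : Type*) [Group G] : ℕ → Subgroup G
  | 0 => ⊤
  | n + 1 => powSubgroup ℓ (lowerSeries ℓ G n) ⊔ ⁅lowerSeries ℓ G n, (⊤ : Subgroup G)⁆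

instance lowerSeries_normal (ℓ : ℕ) (G : Type*) [Group G] :
    ∀ n, (lowerSeries ℓ G n).Normal
  | 0 => inferInstanceAs (⊤ : Subgroup G).Normal
  | n + 1 =>
    haveI := lowerSeries_normal ℓ G n
    inferInstanceAs
      (powSubgroup ℓ (lowerSeries ℓ G n) ⊔ ⁅lowerSeries ℓ G n, (⊤ : Subgroup G)⁆).Normal

/-- `G` is a uniform pro-`ℓ` group of dimension `d`. -/
class IsUniformProL (ℓ : ℕ) (G : Type*) [Group G] [TopologicalSpace G] (d : outParam ℕ) :
    Prop where
  topologicalGroup : IsTopologicalGroup G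
  compact : CompactSpace G
  hausdorff : T2Space G
  totallyDisconnected : TotallyDisconnectedSpace G
  proL : ∀ N : Subgroup G, N.Normal → IsOpen (N : Set G) → ∃ k, N.index = ℓ ^ k
  finitelyGenerated : ∃ s : Finset G, Dense (Subgroup.closure (s : Set G) : Set G)
  powerful : commutator G ≤ powSubgroup (if ℓ = 2 then 4 else ℓ) (⊤ : Subgroup G)
  index_succ : ∀ n, 1 ≤ n →
    (lowerSeries ℓ G (n + 1)).relIndex (lowerSeries ℓ G n) = (lowerSeries ℓ G 1).index
  index_one : (lowerSeries ℓ G 1).index = ℓ ^ d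

theorem lowerSeries_succ_le (ℓ : ℕ) (G : Type*) [Group G] (n : ℕ) :
    lowerSeries ℓ G (n + 1) ≤ lowerSeries ℓ G n := by
  refine sup_le ?_ (Subgroup.commutator_le_left _ _)
  refine (Subgroup.closure_le _).2 ?_
  rintro _ ⟨h, hh, rfl⟩
  exact Subgroup.pow_mem _ hh _

theorem IsUniformProL.index_lowerSeries (ℓ : ℕ) (G : Type*) [Group G] [TopologicalSpace G] {d : ℕ}
    [h : IsUniformProL ℓ G d] (n : ℕ) : (lowerSeries ℓ G n).index = ℓ ^ (d * n) := by
  induction n with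
  | zero => simp [lowerSeries]
  | succ n ih =>
    rcases Nat.eq_zero_or_pos n with rfl | hn
    · simpa using h.index_one
    · rw [← Subgroup.relIndex_mul_index (lowerSeries_succ_le ℓ G n), ih, h.index_succ n hn,
        h.index_one, ← pow_add]
      congr 1
      ring

instance IsUniformProL.finite_quotient (ℓ : ℕ) [hl : Fact ℓ.Prime] (G : Type*) [Group G]
    [TopologicalSpace G] {d : ℕ} [h : IsUniformProL ℓ G d] (n : ℕ) :
    Finite (G ⧸ lowerSeries ℓ G n) := by
  have : (lowerSeries ℓ G n).FiniteIndex := ⟨by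
    rw [IsUniformProL.index_lowerSeries ℓ G n]
    exact pow_ne_zero _ hl.out.ne_zero⟩
  infer_instance

namespace SerreGraph

section Uniform

variable {ℓ : ℕ} [Fact ℓ.Prime] {X : SerreGraph} {G : Type*} [Group G]

/-- The voltage assignment `α_{/n} : S → G / G_n`. -/
def redVoltage (ℓ : ℕ) {X : SerreGraph} {G : Type*} [Group G] (S : Orientation X)
    (α : S.carrier → G) (n : ℕ) : S.carrier → G ⧸ lowerSeries ℓ G n :=
  fun s => QuotientGroup.mk (α s)

/-- The graph `Y_n = X(G / G_n, S, α_{/n})`. -/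
noncomputable abbrev coverGraph (ℓ : ℕ) {X : SerreGraph} {G : Type*} [Group G] (S : Orientation X)
    (α : S.carrier → G) (n : ℕ) : SerreGraph :=
  derived X S (redVoltage ℓ S α n)

/-- The orientation of `Y_n` induced by `S` along the projection `Y_n → X`. -/
noncomputable def coverOrientation (ℓ : ℕ) {X : SerreGraph} {G : Type*} [Group G]
    (S : Orientation X) (α : S.carrier → G) (n : ℕ) : Orientation (coverGraph ℓ S α n) :=
  S.comap (derivedProj X S (redVoltage ℓ S α n))

/-- The voltage assignment on `Y_n` obtained by composing `β` with the projection `Y_n → X`. -/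
noncomputable def coverVoltage (S : Orientation X) (α : S.carrier → G) (β : S.carrier → ℤ_[ℓ])
    (n : ℕ) : (coverOrientation ℓ S α n).carrier → ℤ_[ℓ] :=
  fun s => β ⟨(derivedProj X S (redVoltage ℓ S α n)).onE s, s.2⟩

/-- The tower `Y_n = Y_{n,0} ← Y_{n,1} ← Y_{n,2} ← ⋯` over `Y_n`, where
`Y_{n,m} = X(G / G_n × ℤ/ℓ^m, S, (α_{/n}, β_{/m}))`. -/
noncomputable def coverTower (S : Orientation X) (α : S.carrier → G) (β : S.carrier → ℤ_[ℓ])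
    (n : ℕ) : Tower (coverGraph ℓ S α n) :=
  productTower X S (redVoltage ℓ S α n) β

/-- The `μ`-invariant `μ_n` of the tower over `Y_n`. -/
noncomputable def coverMu [Finite X.V] [Finite X.E] [TopologicalSpace G] {d : ℕ}
    [IsUniformProL ℓ G d] (S : Orientation X) (α : S.carrier → G) (β : S.carrier → ℤ_[ℓ])
    (n : ℕ) : ℕ∞ :=
  muInv (coverGraph ℓ S α n) (coverOrientation ℓ S α n) (coverVoltage S α β n)

/-- The `λ`-invariant `λ_n` of the tower over `Y_n`. -/
noncomputable def coverLambda [Finite X.V] [Finite X.E] [TopologicalSpace G] {d : ℕ}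
    [IsUniformProL ℓ G d] (S : Orientation X) (α : S.carrier → G) (β : S.carrier → ℤ_[ℓ])
    (n : ℕ) : ℤ :=
  lambdaInv (coverGraph ℓ S α n) (coverOrientation ℓ S α n) (coverVoltage S α β n)

end Uniform

end SerreGraph

/-!
The covering `Y_n → X` is a Galois covering with group `K = G / G_n`, a finite `ℓ`-group of order
`ℓ ^ (d * n)`, and the proof compares the characteristic series of `Y_n` and `X` modulo `ℓ`.

Sorting directed edges by their voltage in `K` writes `D - A_ρ` for `X` as a sum `∑ g, M g`
over `g ∈ K`, and then `D - A_ρ` for `Y_n` is `∑ g, M g ⊗ P g`, where `P` is the right regular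
representation of `K` (`SerreGraph.charSeries_derived`). Over `𝔽_ℓ` every representation of an
`ℓ`-group is unipotent, because counting orbits produces a nonzero fixed vector; hence in a
suitable basis all `P g` are unitriangular and the determinant of `∑ g, M g ⊗ P g` is
`det (∑ g, M g) ^ |K|` (`IsPGroup.det_sum_kronecker`). So modulo `ℓ` the characteristic series of
`Y_n` is the `ℓ ^ (d * n)`-th power of that of `X` (`SerreGraph.map_charSeries_derived`).

The condition `μ = 0` says that the reduction modulo `ℓ` is nonzero, and then `λ + 1` is its order
of vanishing (`SerreGraph.seriesLambda_eq_order`), which is multiplicative under powers in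
`𝔽_ℓ⟦T⟧`. For `n = 0` the group `K` is trivial and the two characteristic series agree exactly.
The isomorphism of towers only rebrackets `V_X × (K × ℤ/ℓ^m)`
(`SerreGraph.productTower_isomorphic`).
-/

/-! ### Determinants over an `ℓ`-group in characteristic `ℓ` -/

section Unipotent

open Matrix
open scoped Kronecker

/-- An `ℓ`-group acting linearly on a nonzero finite vector space over `𝔽_ℓ` fixes a nonzero
vector, by counting fixed points modulo `ℓ`. -/
theorem IsPGroup.exists_mulVec_eq_self {ℓ : ℕ} [Fact ℓ.Prime] {K : Type*} [Group K]
    (hK : IsPGroup ℓ K) {ι : Type*} [Fintype ι] [DecidableEq ι] [Nonempty ι] (ρ : K →* Matrix ι ι (ZMod ℓ)) :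
    ∃ v : ι → ZMod ℓ, v ≠ 0 ∧ ∀ g, ρ g *ᵥ v = v := by
  let _ : MulAction K (ι → ZMod ℓ) :=
    { smul := fun g v => ρ g *ᵥ v
      one_smul := fun v => by change ρ 1 *ᵥ v = v; simp
      mul_smul := fun g h v => by change ρ (g * h) *ᵥ v = ρ g *ᵥ (ρ h *ᵥ v); simp }
  have hdvd : ℓ ∣ Nat.card (ι → ZMod ℓ) := by
    rw [Nat.card_fun, Nat.card_zmod]
    exact dvd_pow_self _ (Nat.card_pos.ne')
  obtain ⟨v, hv, hne⟩ := hK.exists_fixed_point_of_prime_dvd_card_of_fixed_point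
    (ι → ZMod ℓ) hdvd (a := 0) (fun g => Matrix.mulVec_zero (ρ g))
  exact ⟨v, hne.symm, fun g => hv g⟩

/-- If `v i ≠ 0`, then `v` is the `i`-th column of an invertible matrix. -/
theorem Matrix.exists_inverse_col_eq {F : Type*} [Field F] {ι : Type*} [Fintype ι] [DecidableEq ι]
    (v : ι → F) (i : ι) (hv : v i ≠ 0) :
    ∃ P Q : Matrix ι ι F, P * Q = 1 ∧ Q * P = 1 ∧ P *ᵥ Pi.single i 1 = v := by
  -- Replacing the `i`-th column of the identity by `v` gives determinant `v i`.
  set P := (1 : Matrix ι ι F).updateCol i v with hP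
  have hdet : IsUnit P.det := by
    rw [hP, ← Matrix.cramer_apply, Matrix.cramer_one]
    simpa using hv
  refine ⟨P, P⁻¹, Matrix.mul_nonsing_inv _ hdet, Matrix.nonsing_inv_mul _ hdet, ?_⟩
  ext j
  simp [hP]

/-- The determinant of `∑ g, M g ⊗ ρ g` is unchanged when `ρ` is conjugated. -/
theorem Matrix.det_sum_kronecker_conj {R : Type*} [CommRing R] {K V ι : Type*}
    [Fintype K] [Fintype V] [DecidableEq V] [Fintype ι] [DecidableEq ι] (M : K → Matrix V V R) (ρ : K → Matrix ι ι R)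
    (P Q : Matrix ι ι R) (hPQ : P * Q = 1) :
    (∑ g, M g ⊗ₖ (Q * ρ g * P)).det = (∑ g, M g ⊗ₖ ρ g).det := by
  have h1 : ∑ g, M g ⊗ₖ (Q * ρ g * P)
      = ((1 : Matrix V V R) ⊗ₖ Q) * (∑ g, M g ⊗ₖ ρ g) * ((1 : Matrix V V R) ⊗ₖ P) := by
    simp only [Finset.mul_sum, Finset.sum_mul, ← Matrix.mul_kronecker_mul, one_mul, mul_one]
  have h2 : ((1 : Matrix V V R) ⊗ₖ P).det * ((1 : Matrix V V R) ⊗ₖ Q).det = 1 := by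
    rw [← Matrix.det_mul, ← Matrix.mul_kronecker_mul, hPQ]
    simp
  rw [h1, Matrix.det_mul, Matrix.det_mul, mul_comm, ← mul_assoc, h2, one_mul]

/-- Representations of an `ℓ`-group over `𝔽_ℓ` are unipotent: for the determinant of
`∑ g, M g ⊗ ρ g`, the representation `ρ` counts as `dim ρ` copies of the trivial one. -/
theorem IsPGroup.det_sum_kronecker {ℓ : ℕ} [Fact ℓ.Prime] {K : Type*} [Group K] [Fintype K]
    (hK : IsPGroup ℓ K) {R : Type*} [CommRing R] (f : ZMod ℓ →+* R) {V : Type*} [Fintype V]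
    [DecidableEq V] (M : K → Matrix V V R) {ι : Type*} [Fintype ι] [DecidableEq ι]
    (ρ : K →* Matrix ι ι (ZMod ℓ)) :
    (∑ g, M g ⊗ₖ (ρ g).map f).det = (∑ g, M g).det ^ Fintype.card ι := by
  obtain ⟨n, hn⟩ : ∃ n, Fintype.card ι = n := ⟨_, rfl⟩
  induction n generalizing ι with
  | zero =>
    have : IsEmpty ι := Fintype.card_eq_zero_iff.1 hn
    rw [hn, pow_zero, Matrix.det_isEmpty]
  | succ n ih =>
    have : Nonempty ι := Fintype.card_pos_iff.1 (by omega)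
    obtain ⟨v, hv0, hv⟩ := hK.exists_mulVec_eq_self ρ
    obtain ⟨i₀, hi₀⟩ := Function.ne_iff.1 hv0
    obtain ⟨P, Q, hPQ, hQP, hPv⟩ := Matrix.exists_inverse_col_eq v i₀ hi₀
    set ρ' : K → Matrix ι ι (ZMod ℓ) := fun g => Q * ρ g * P with hρ'
    have hone : ρ' 1 = 1 := by simp [hρ', hQP]
    have hmul : ∀ g h, ρ' (g * h) = ρ' g * ρ' h := fun g h => by
      calc Q * ρ (g * h) * P = Q * ρ g * 1 * ρ h * P := by simp [mul_assoc]
        _ = Q * ρ g * (P * Q) * ρ h * P := by rw [hPQ]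
        _ = Q * ρ g * P * (Q * ρ h * P) := by simp only [mul_assoc]
    -- In the new basis the `i₀`-th basis vector is fixed by every group element.
    have hcol : ∀ g i, ρ' g i i₀ = if i = i₀ then 1 else 0 := fun g i => by
      have h : ρ' g *ᵥ Pi.single i₀ 1 = Pi.single i₀ 1 := by
        rw [hρ']
        simp only
        rw [← Matrix.mulVec_mulVec, hPv, ← Matrix.mulVec_mulVec, hv, ← hPv, Matrix.mulVec_mulVec,
          hQP, Matrix.one_mulVec]
      have h' := congrFun h i
      rw [Matrix.mulVec_single_one] at h'
      simpa [Matrix.col_apply, Pi.single_apply] using h'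
    -- The quotient by the fixed line is again a representation.
    let τ : K →* Matrix {i // i ≠ i₀} {i // i ≠ i₀} (ZMod ℓ) :=
      { toFun := fun g => (ρ' g).submatrix (↑) (↑)
        map_one' := by
          rw [hone]
          exact Matrix.submatrix_one _ Subtype.val_injective
        map_mul' := fun g h => by
          ext i j
          rw [hmul]
          simp only [Matrix.submatrix_apply, Matrix.mul_apply]
          rw [← Finset.add_sum_erase _ _ (Finset.mem_univ i₀), hcol, if_neg i.2, zero_mul, zero_add]
          exact (Finset.sum_subtype _ (by simp) (fun l => ρ' g i l * ρ' h l j)) }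
    have hcard : Fintype.card {i // i ≠ i₀} = n := by
      rw [Fintype.card_subtype_compl, hn]
      simp
    have hconj := Matrix.det_sum_kronecker_conj M (fun g => (ρ g).map f) (P.map f) (Q.map f)
      (by rw [← Matrix.map_mul, hPQ, Matrix.map_one _ f.map_zero f.map_one])
    simp only [← Matrix.map_mul] at hconj
    rw [← hconj, hn, pow_succ', ← hcard, ← ih τ hcard]
    change (∑ g, M g ⊗ₖ (ρ' g).map f).det = _
    rw [Matrix.twoBlockTriangular_det _ (fun x : V × ι => x.2 = i₀)]
    · congr 1
      · let e : V ≃ {x : V × ι // x.2 = i₀} :=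
          ⟨fun w => ⟨(w, i₀), rfl⟩, fun x => x.1.1, fun _ => rfl, fun ⟨⟨w, i⟩, h⟩ => by
            subst h; rfl⟩
        rw [← Matrix.det_submatrix_equiv_self e]
        congr 1
        ext i j
        simp [Matrix.toSquareBlockProp, Matrix.sum_apply, e, hcol]
      · let e : V × {i // i ≠ i₀} ≃ {x : V × ι // ¬ x.2 = i₀} :=
          ⟨fun w => ⟨(w.1, w.2), w.2.2⟩, fun x => (x.1.1, ⟨x.1.2, x.2⟩), fun _ => rfl,
            fun _ => rfl⟩
        rw [← Matrix.det_submatrix_equiv_self e]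
        congr 1
        ext i j
        simp [Matrix.toSquareBlockProp, Matrix.sum_apply, e, τ]
    · rintro ⟨i, k⟩ hk ⟨j, k'⟩ rfl
      simp only at hk
      simp [Matrix.sum_apply, hcol, hk]

end Unipotent

/-! ### The characteristic series of a derived graph -/

namespace SerreGraph

open Matrix
open scoped Kronecker

/-- The right regular representation of `K` by permutation matrices: the matrix of `g` has the
entry `1` exactly at the positions `(σ, σ g)`. -/
def rightRegular (A : Type*) [CommSemiring A] (K : Type*) [Group K] [Fintype K] [DecidableEq K] :
    K →* Matrix K K A where
  toFun g := Matrix.of fun σ τ => if σ * g = τ then 1 else 0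
  map_one' := by
    ext σ τ
    simp [Matrix.one_apply]
  map_mul' g h := by
    ext σ τ
    simp only [Matrix.mul_apply, Matrix.of_apply, ite_mul, one_mul, zero_mul, Finset.sum_ite_eq,
      Finset.mem_univ, if_true, mul_assoc]

variable {ℓ : ℕ} [Fact ℓ.Prime]

theorem charSeries_eq_det (Y : SerreGraph) [Fintype Y.V] [DecidableEq Y.V] [Finite Y.E]
    (S : Orientation Y) (β : S.carrier → ℤ_[ℓ]) :
    charSeries Y S β =
      (Matrix.diagonal (fun v => (Y.val v : PowerSeries ℤ_[ℓ])) - adjRho Y S β).det := by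
  unfold charSeries
  congr!

theorem adjRho_apply (Y : SerreGraph) [DecidableEq Y.V] [Finite Y.E] (S : Orientation Y)
    [Fintype S.carrier] (β : S.carrier → ℤ_[ℓ]) (i j : Y.V) :
    adjRho Y S β i j = ∑ s : S.carrier,
      ((if Y.o s = i ∧ Y.t s = j then PowerSeries.binomialSeries ℤ_[ℓ] (β s) else 0) +
        (if Y.o s = j ∧ Y.t s = i then PowerSeries.binomialSeries ℤ_[ℓ] (-β s) else 0)) := by
  unfold adjRho
  congr!

/-- The part of `D - A_ρ` belonging to the group element `g`: the valencies if `g = 1`,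
minus the contribution `(1 + T) ^ β` of each directed edge of voltage `g`. -/
noncomputable def voltagePart (X : SerreGraph) [DecidableEq X.V] (S : Orientation X)
    [Fintype S.carrier] {K : Type*} [Group K] [DecidableEq K] (α : S.carrier → K)
    (β : S.carrier → ℤ_[ℓ]) (g : K) : Matrix X.V X.V (PowerSeries ℤ_[ℓ]) :=
  fun i j => (if i = j ∧ g = 1 then (X.val i : PowerSeries ℤ_[ℓ]) else 0) -
    ∑ s : S.carrier,
      ((if (X.o s = i ∧ X.t s = j) ∧ g = α s
          then PowerSeries.binomialSeries ℤ_[ℓ] (β s) else 0) +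
        (if (X.o s = j ∧ X.t s = i) ∧ g = (α s)⁻¹
          then PowerSeries.binomialSeries ℤ_[ℓ] (-β s) else 0))

theorem sum_voltagePart (X : SerreGraph) [DecidableEq X.V] [Finite X.E] (S : Orientation X)
    [Fintype S.carrier] {K : Type*} [Group K] [Fintype K] [DecidableEq K] (α : S.carrier → K)
    (β : S.carrier → ℤ_[ℓ]) :
    ∑ g, voltagePart X S α β g =
      Matrix.diagonal (fun v => (X.val v : PowerSeries ℤ_[ℓ])) - adjRho X S β := by
  ext1 i j
  rw [Matrix.sum_apply, Matrix.sub_apply, adjRho_apply, Matrix.diagonal_apply]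
  unfold voltagePart
  rw [Finset.sum_sub_distrib, Finset.sum_comm]
  simp only [Finset.sum_add_distrib, ite_and, Finset.sum_ite_irrel, Finset.sum_ite_eq',
    Finset.mem_univ, if_true, Finset.sum_const_zero]

theorem val_derived (X : SerreGraph) (S : Orientation X) {K : Type*} [Group K]
    (α : S.carrier → K) (v : (derived X S α).V) : (derived X S α).val v = X.val v.1 := by
  refine Nat.card_congr
    ⟨fun e => ⟨e.1.1, congrArg Prod.fst e.2⟩, fun e => ⟨(e.1, v.2), Prod.ext e.2 rfl⟩, ?_, ?_⟩
  · rintro ⟨⟨e, σ⟩, h⟩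
    exact Subtype.ext (Prod.ext rfl (congrArg Prod.snd h).symm)
  · exact fun _ => rfl

/-- The matrix `D - A_ρ` of a derived graph is the image of a matrix over the group ring
`ℤ_ℓ⟦T⟧[K]` under the regular representation. -/
theorem charSeries_derived (X : SerreGraph) [Fintype X.V] [DecidableEq X.V] [Finite X.E]
    (S : Orientation X) [Fintype S.carrier] {K : Type*} [Group K] [Fintype K] [DecidableEq K]
    (α : S.carrier → K) (β : S.carrier → ℤ_[ℓ]) :
    charSeries (derived X S α) (S.comap (derivedProj X S α)) (fun s => β ⟨s.1.1, s.2⟩) =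
      (∑ g, voltagePart X S α β g ⊗ₖ rightRegular (PowerSeries ℤ_[ℓ]) K g).det := by
  let _ : Fintype (derived X S α).V := inferInstanceAs (Fintype (X.V × K))
  let _ : DecidableEq (derived X S α).V := inferInstanceAs (DecidableEq (X.V × K))
  let e : S.carrier × K ≃ (S.comap (derivedProj X S α)).carrier :=
    ⟨fun x => ⟨(x.1.1, x.2), x.1.2⟩, fun s => (⟨s.1.1, s.2⟩, s.1.2), fun _ => rfl, fun _ => rfl⟩
  let _ : Fintype (S.comap (derivedProj X S α)).carrier := Fintype.ofEquiv _ e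
  rw [charSeries_eq_det]
  refine congrArg Matrix.det (a₁ := (_ : Matrix (X.V × K) (X.V × K) (PowerSeries ℤ_[ℓ]))) ?_
  ext1 ⟨i, σ⟩ ⟨j, τ⟩
  have hR : (∑ g, voltagePart X S α β g ⊗ₖ rightRegular (PowerSeries ℤ_[ℓ]) K g) (i, σ) (j, τ) =
      voltagePart X S α β (σ⁻¹ * τ) i j := by
    simp [Matrix.sum_apply, rightRegular, ← eq_inv_mul_iff_mul_eq]
  have hα : ∀ s : S.carrier, extend S α s = α s := fun s => by simp [extend]
  rw [hR]
  unfold voltagePart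
  refine (Matrix.sub_apply _ _ _ _).trans (congrArg₂ (· - ·) ?_ ?_)
  · refine (Matrix.diagonal_apply _ _ _).trans ?_
    refine ite_congr (propext ?_) (fun _ => congrArg Nat.cast (val_derived X S α _)) fun _ => rfl
    rw [inv_mul_eq_one]
    exact Prod.ext_iff
  · refine (adjRho_apply _ _ _ _ _).trans ?_
    rw [← e.sum_comp, Fintype.sum_prod_type]
    refine Finset.sum_congr rfl fun s _ => ?_
    rw [Finset.sum_add_distrib]
    have h1 : ∀ κ : K, ((derived X S α).o (e (s, κ)) = (i, σ) ∧
        (derived X S α).t (e (s, κ)) = (j, τ)) ↔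
          κ = σ ∧ ((X.o s = i ∧ X.t s = j) ∧ σ⁻¹ * τ = α s) := fun κ => by
      change ((X.o s, κ) = (i, σ) ∧ (X.t s, κ * extend S α s) = (j, τ)) ↔ _
      rw [hα, Prod.mk.injEq, Prod.mk.injEq, inv_mul_eq_iff_eq_mul]
      constructor
      · rintro ⟨⟨rfl, rfl⟩, rfl, rfl⟩; simp
      · rintro ⟨rfl, ⟨rfl, rfl⟩, rfl⟩; simp
    have h2 : ∀ κ : K, ((derived X S α).o (e (s, κ)) = (j, τ) ∧
        (derived X S α).t (e (s, κ)) = (i, σ)) ↔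
          κ = τ ∧ ((X.o s = j ∧ X.t s = i) ∧ σ⁻¹ * τ = (α s)⁻¹) := fun κ => by
      change ((X.o s, κ) = (j, τ) ∧ (X.t s, κ * extend S α s) = (i, σ)) ↔ _
      rw [hα, Prod.mk.injEq, Prod.mk.injEq, inv_mul_eq_iff_eq_mul, eq_mul_inv_iff_mul_eq]
      constructor
      · rintro ⟨⟨rfl, rfl⟩, rfl, rfl⟩; simp
      · rintro ⟨rfl, ⟨rfl, rfl⟩, rfl⟩; simp
    congr 1
    · refine (Finset.sum_congr rfl fun κ _ =>
        ite_congr (propext (h1 κ)) (fun _ => rfl) fun _ => rfl).trans ?_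
      simp only [ite_and, Finset.sum_ite_eq', Finset.mem_univ, if_true]
      rfl
    · refine (Finset.sum_congr rfl fun κ _ =>
        ite_congr (propext (h2 κ)) (fun _ => rfl) fun _ => rfl).trans ?_
      simp only [ite_and, Finset.sum_ite_eq', Finset.mem_univ, if_true]
      rfl

/-- A cover with trivial group has the characteristic series of the base. -/
theorem charSeries_derived_of_subsingleton (X : SerreGraph) [Finite X.V] [Finite X.E]
    (S : Orientation X) {K : Type*} [Group K] [Subsingleton K] [Finite K] (α : S.carrier → K)
    (β : S.carrier → ℤ_[ℓ]) :
    charSeries (derived X S α) (S.comap (derivedProj X S α)) (fun s => β ⟨s.1.1, s.2⟩) =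
      charSeries X S β := by
  classical
  let _ := Fintype.ofFinite X.V
  let _ := Fintype.ofFinite S.carrier
  let _ := Fintype.ofFinite K
  have h1 : ∀ g, rightRegular (PowerSeries ℤ_[ℓ]) K g = 1 := fun g => by
    rw [Subsingleton.elim g 1, map_one]
  have hsum : ∑ g, voltagePart X S α β g ⊗ₖ (1 : Matrix K K (PowerSeries ℤ_[ℓ])) =
      (∑ g, voltagePart X S α β g) ⊗ₖ (1 : Matrix K K (PowerSeries ℤ_[ℓ])) := by
    ext1 i j
    simp [Matrix.sum_apply, Finset.sum_mul]
  have hcard : Fintype.card K = 1 := Fintype.card_eq_one_iff.2 ⟨1, fun _ => Subsingleton.elim _ _⟩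
  rw [charSeries_derived, charSeries_eq_det X, ← sum_voltagePart X S α β]
  simp only [h1, hsum]
  rw [Matrix.det_kronecker, hcard, Matrix.det_one, one_pow, mul_one, pow_one]

end SerreGraph

/-! ### Iwasawa invariants and reduction modulo `ℓ` -/

namespace SerreGraph

open Matrix
open scoped Kronecker

variable {ℓ : ℕ} [Fact ℓ.Prime]

theorem ord_eq_zero_iff (a : ℤ_[ℓ]) : ord a = 0 ↔ PadicInt.toZMod a ≠ 0 := by
  rw [ord, emultiplicity_eq_zero, not_iff_not, ← RingHom.mem_ker, PadicInt.ker_toZMod,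
    PadicInt.maximalIdeal_eq_span_p, Ideal.mem_span_singleton]

theorem seriesMu_eq_zero_iff (Q : PowerSeries ℤ_[ℓ]) :
    seriesMu Q = 0 ↔ PowerSeries.map PadicInt.toZMod Q ≠ 0 := by
  rw [seriesMu, ENat.iInf_eq_zero, Ne, PowerSeries.ext_iff, not_forall]
  simp [ord_eq_zero_iff]

/-- If `μ(Q) = 0`, then `λ(Q)` is the order of vanishing of the reduction modulo `ℓ`. -/
theorem seriesLambda_eq_order {Q : PowerSeries ℤ_[ℓ]} (h : seriesMu Q = 0) :
    (seriesLambda Q : ℕ∞) = (PowerSeries.map PadicInt.toZMod Q).order := by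
  have hne : {i | ord (PowerSeries.coeff i Q) = seriesMu Q}.Nonempty := by
    rw [h]
    exact ENat.iInf_eq_zero.1 h
  symm
  rw [PowerSeries.order_eq_nat]
  simp only [PowerSeries.coeff_map]
  refine ⟨(ord_eq_zero_iff _).1 ((Nat.sInf_mem hne).trans h), fun i hi => ?_⟩
  by_contra hc
  exact Nat.notMem_of_lt_sInf hi (((ord_eq_zero_iff _).2 hc).trans h.symm)

theorem seriesLambda_of_map_eq_pow {P Q : PowerSeries ℤ_[ℓ]} {n : ℕ}
    (h : PowerSeries.map PadicInt.toZMod P = PowerSeries.map PadicInt.toZMod Q ^ n)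
    (hQ : seriesMu Q = 0) : seriesMu P = 0 ∧ seriesLambda P = n * seriesLambda Q := by
  have hP : seriesMu P = 0 := by
    rw [seriesMu_eq_zero_iff] at hQ ⊢
    rw [h]
    exact pow_ne_zero n hQ
  refine ⟨hP, ?_⟩
  have h' := seriesLambda_eq_order hP
  rw [h, PowerSeries.order_pow, ← seriesLambda_eq_order hQ, nsmul_eq_mul] at h'
  exact_mod_cast h'

/-- Modulo `ℓ`, the characteristic series of an `ℓ`-group cover is a power of that of the base. -/
theorem map_charSeries_derived (X : SerreGraph) [Finite X.V] [Finite X.E] (S : Orientation X)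
    {K : Type*} [Group K] [Finite K] (hK : IsPGroup ℓ K) (α : S.carrier → K)
    (β : S.carrier → ℤ_[ℓ]) :
    PowerSeries.map PadicInt.toZMod (charSeries (derived X S α) (S.comap (derivedProj X S α))
      (fun s => β ⟨s.1.1, s.2⟩)) =
      PowerSeries.map PadicInt.toZMod (charSeries X S β) ^ Nat.card K := by
  classical
  let _ := Fintype.ofFinite X.V
  let _ := Fintype.ofFinite S.carrier
  let _ := Fintype.ofFinite K
  set φ := PowerSeries.map (PadicInt.toZMod (p := ℓ)) with hφ
  have hreg : ∀ g, (rightRegular (PowerSeries ℤ_[ℓ]) K g).map φ =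
      (rightRegular (ZMod ℓ) K g).map (PowerSeries.C (R := ZMod ℓ)) := fun g => by
    ext1 σ τ
    simp [rightRegular, apply_ite]
  have hsum : φ.mapMatrix (∑ g, voltagePart X S α β g) =
      ∑ g, φ.mapMatrix (voltagePart X S α β g) := map_sum _ _ _
  have hker : φ.mapMatrix
        (∑ g, voltagePart X S α β g ⊗ₖ rightRegular (PowerSeries ℤ_[ℓ]) K g) =
      ∑ g, φ.mapMatrix (voltagePart X S α β g) ⊗ₖ
        (rightRegular (ZMod ℓ) K g).map (PowerSeries.C (R := ZMod ℓ)) := by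
    rw [map_sum]
    refine Finset.sum_congr rfl fun g _ => ?_
    rw [← hreg]
    ext1 i j
    simp
  rw [charSeries_derived, charSeries_eq_det X, ← sum_voltagePart X S α β, RingHom.map_det,
    RingHom.map_det, hsum, hker, hK.det_sum_kronecker, Nat.card_eq_fintype_card]

/-! ### The pullback tower -/

/-- The product tower over `X(K, S, α)` is the voltage tower of the pullback of `β`: both have the
vertices `V_X × K × ℤ/ℓ^m` up to bracketing. -/
theorem productTower_isomorphic (X : SerreGraph) (S : Orientation X) {K : Type*} [Group K]
    (α : S.carrier → K) (β : S.carrier → ℤ_[ℓ]) :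
    (productTower X S α β).Isomorphic (voltageTower (derived X S α)
      (S.comap (derivedProj X S α)) (fun s => β ⟨s.1.1, s.2⟩)) := by
  have hα : ∀ m e, (extend S (fun s => (α s, redMod m (β s))) e).1 = extend S α e := fun m e =>
    (extend_map S (MonoidHom.fst K (Cyc ℓ m)) (fun s => (α s, redMod m (β s))) e).symm
  have hβ : ∀ m e (σ : K), (extend S (fun s => (α s, redMod m (β s))) e).2 =
      extend (S.comap (derivedProj X S α)) (fun s => redMod m (β ⟨s.1.1, s.2⟩)) (e, σ) :=
    fun m e σ =>
      (extend_map S (MonoidHom.snd K (Cyc ℓ m)) (fun s => (α s, redMod m (β s))) e).symm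
  refine ⟨fun m =>
    { onV := fun v => ((v.1, v.2.1), v.2.2)
      onE := fun e => ((e.1, e.2.1), e.2.2)
      map_o := fun _ => rfl
      map_t := fun e => ?_
      map_inv := fun e => ?_ }, fun m => ⟨⟨?_, ?_⟩, rfl, rfl⟩⟩
  · exact Prod.ext (Prod.ext rfl (congrArg (e.2.1 * ·) (hα m e.1)))
      (congrArg (e.2.2 * ·) (hβ m e.1 e.2.1))
  · exact Prod.ext (Prod.ext rfl (congrArg (e.2.1 * ·) (hα m e.1)))
      (congrArg (e.2.2 * ·) (hβ m e.1 e.2.1))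
  · exact (Equiv.prodAssoc X.V K (Cyc ℓ m)).symm.bijective
  · exact (Equiv.prodAssoc X.E K (Cyc ℓ m)).symm.bijective

end SerreGraph

theorem theorem5p2 {ℓ : ℕ} [Fact ℓ.Prime]
    (X : SerreGraph) [Finite X.V] [Finite X.E] (S : X.Orientation)
    {G : Type*} [Group G] [TopologicalSpace G] {d : ℕ} [IsUniformProL ℓ G d]
    (α : S.carrier → G) (β : S.carrier → ℤ_[ℓ])
    (hconn : ∀ n m, ((SerreGraph.coverTower S α β n).level m).Connected) :
    (∀ n, (SerreGraph.coverTower S α β n).Isomorphic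
      (SerreGraph.voltageTower (SerreGraph.coverGraph ℓ S α n)
        (SerreGraph.coverOrientation ℓ S α n) (SerreGraph.coverVoltage S α β n))) ∧
    (SerreGraph.coverMu S α β 0 = SerreGraph.muInv X S β ∧
      SerreGraph.coverLambda S α β 0 = SerreGraph.lambdaInv X S β) ∧
    (SerreGraph.coverMu S α β 0 = 0 →
      ∀ n, SerreGraph.coverMu S α β n = 0 ∧
        SerreGraph.coverLambda S α β n =
          (ℓ : ℤ) ^ (d * n) * (SerreGraph.coverLambda S α β 0 + 1) - 1) := by
  have hcard : ∀ n, Nat.card (G ⧸ lowerSeries ℓ G n) = ℓ ^ (d * n) :=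
    IsUniformProL.index_lowerSeries ℓ G
  have hsub : Subsingleton (G ⧸ lowerSeries ℓ G 0) :=
    (Nat.card_eq_one_iff_unique.1 (by simpa using hcard 0)).1
  have hzero := SerreGraph.charSeries_derived_of_subsingleton X S
    (SerreGraph.redVoltage ℓ S α 0) β
  have hmu : SerreGraph.coverMu S α β 0 = SerreGraph.muInv X S β :=
    congrArg SerreGraph.seriesMu hzero
  have hlambda : SerreGraph.coverLambda S α β 0 = SerreGraph.lambdaInv X S β :=
    congrArg (fun Q => (SerreGraph.seriesLambda Q : ℤ) - 1) hzero
  refine ⟨fun n => SerreGraph.productTower_isomorphic X S (SerreGraph.redVoltage ℓ S α n) β,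
    ⟨hmu, hlambda⟩, fun h n => ?_⟩
  have hn := SerreGraph.map_charSeries_derived X S (IsPGroup.of_card (hcard n))
    (SerreGraph.redVoltage ℓ S α n) β
  rw [hcard] at hn
  obtain ⟨h1, h2⟩ := SerreGraph.seriesLambda_of_map_eq_pow hn (hmu.symm.trans h)
  refine ⟨h1, ?_⟩
  rw [hlambda]
  refine (congrArg (fun k : ℕ => (k : ℤ) - 1) h2).trans ?_
  simp [SerreGraph.lambdaInv]
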